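/- Let $a>0$ and let $q\colon[-a,a]\to\mathbb{C}$ be continuous. Suppose that either $q\in C^1[-a,a]$, or there is a complex-valued solution $g\in C^2[-a,a]$ of $g''-qg=0$ with $g(x)\neq 0$ for all $x\in[-a,a]$. Then the Goursat problem $$\frac{\partial^2 H(u,v)}{\partial u\,\partial v}=q(u+v)H(u,v),\qquad H(u,0)=\frac12\int_0^u q(s)\,ds,\qquad H(0,v)=0$$ has a unique continuous solution $H$ on $\{(u,v)\in\mathbb{R}^2: uv\ge 0,\ |u+v|\le a\}$ (derivatives at boundary points being taken within this set). Put, for $|t|\le|x|\le a$ and $h\in\mathbb{C}$, $$K(x,t)=H\Big(\frac{x+t}2,\frac{x-t}2\Big),\qquad \mathbf K(x,t;h)=\frac h2+K(x,t)+\frac h2\int_t^x\big(K(x,s)-K(x,-s)\big)\,ds,$$ $$\mathbf T_h u(x)=u(x)+\int_{-x}^{x}\mathbf K(x,t;h)\,u(t)\,dt,\qquad u\in C[-a,a],\ x\in[-a,a].$$ Then for every $h\in\mathbb{C}$ the operator $\mathbf T_h$ is a transmutation operator on $C[-a,a]$ (with the topology of uniform convergence) for the pair $-\frac{d^2}{dx^2}+q$,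 $-\frac{d^2}{dx^2}$ with domain $C^2[-a,a]$. That is, $\mathbf T_h$ is a linear bijection of $C[-a,a]$ onto itself, $\mathbf T_h$ and its inverse are continuous, $\mathbf T_h$ maps $C^2[-a,a]$ into $C^2[-a,a]$, and $$\Big(-\frac{d^2}{dx^2}+q(x)\Big)\mathbf T_h[u]=\mathbf T_h\Big[-\frac{d^2u}{dx^2}\Big]\qquad\text{for all }u\in C^2[-a,a].$$ -/

import Mathlib

namespace Transmutation

open Set

/-- `C[-a,a]`: complex-valued continuous functions on `[-a,a]`, with the topology of uniform
convergence. -/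
abbrev CSpace (a : ℝ) : Type := C(Icc (-a) a, ℂ)

/-- A function on `[-a,a]` regarded as a function on `ℝ` (constant beyond the end points). It is
only ever used through its values and one-sided derivatives on `[-a,a]`. -/
noncomputable def onReal {a : ℝ} (ha : 0 < a) (u : CSpace a) : ℝ → ℂ :=
  IccExtend (neg_le_self ha.le) u

theorem onReal_add {a : ℝ} (ha : 0 < a) (u v : CSpace a) :
    onReal ha (u + v) = onReal ha u + onReal ha v := rfl

theorem onReal_smul {a : ℝ} (ha : 0 < a) (c : ℂ) (u : CSpace a) :
    onReal ha (c • u) = c • onReal ha u := rfl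

theorem onReal_zero {a : ℝ} (ha : 0 < a) : onReal ha (0 : CSpace a) = fun _ => 0 := rfl

/-- `C²[-a,a]` as a linear subspace of `C[-a,a]`. -/
def C2Space {a : ℝ} (ha : 0 < a) : Submodule ℂ (CSpace a) where
  carrier := {u | ContDiffOn ℝ 2 (onReal ha u) (Icc (-a) a)}
  add_mem' := by
    intro u v hu hv
    rw [mem_ofPred_eq, onReal_add]
    exact ContDiffOn.add hu hv
  zero_mem' := by
    rw [mem_ofPred_eq, onReal_zero]
    exact contDiffOn_const
  smul_mem' := by
    intro c u hu
    rw [mem_ofPred_eq, onReal_smul]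
    exact ContDiffOn.const_smul c hu

theorem uniqueDiffOn_seg {a : ℝ} (ha : 0 < a) : UniqueDiffOn ℝ (Icc (-a) a) :=
  uniqueDiffOn_Icc (neg_lt_self ha)

/-- The operator `d²/dx² : C²[-a,a] → C[-a,a]` (one-sided derivatives at the end points). -/
noncomputable def secondDeriv {a : ℝ} (ha : 0 < a) : C2Space ha →ₗ[ℂ] CSpace a where
  toFun u :=
    { toFun := fun x => iteratedDerivWithin 2 (onReal ha u) (Icc (-a) a) x
      continuous_toFun := continuousOn_iff_continuous_domRestrict.1
        (ContDiffOn.continuousOn_iteratedDerivWithin u.2 le_rfl (uniqueDiffOn_seg ha)) }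
  map_add' := by
    intro u v
    ext x
    exact iteratedDerivWithin_add x.2 (uniqueDiffOn_seg ha) (u.2 x x.2) (v.2 x x.2)
  map_smul' := by
    intro c u
    ext x
    exact iteratedDerivWithin_const_smul x.2 (uniqueDiffOn_seg ha) c (u.2 x x.2)

/-- The operator `-d²/dx² + q : C²[-a,a] → C[-a,a]`. -/
noncomputable def schrodinger {a : ℝ} (ha : 0 < a) (q : CSpace a) :
    C2Space ha →ₗ[ℂ] CSpace a :=
  -secondDeriv ha + (LinearMap.mulLeft ℂ q).comp (C2Space ha).subtype

/-- `T` is a transmutation operator on `E` for the operators `A, B : E₁ → E`: a linear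
homeomorphism of `E` leaving `E₁` invariant, with `A T = T B` on `E₁`. -/
def IsTransmutation {E : Type*} [AddCommGroup E] [Module ℂ E] [TopologicalSpace E]
    {E₁ : Submodule ℂ E} (A B : E₁ →ₗ[ℂ] E) (T : E ≃L[ℂ] E) : Prop :=
  ∃ hT : ∀ u ∈ E₁, T u ∈ E₁, ∀ u : E₁, A ⟨T u, hT u u.2⟩ = T (B u)

/-- The image of `{(x,t) : |t| ≤ |x| ≤ a}` in the characteristic coordinates
`u = (x+t)/2`, `v = (x-t)/2`: two closed triangles with a common vertex at the origin. -/
def goursatDomain (a : ℝ) : Set (ℝ × ℝ) := {p | 0 ≤ p.1 * p.2 ∧ |p.1 + p.2| ≤ a}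

/-- `H` solves the Goursat problem
`∂²H/∂u∂v = q(u+v) H`, `H(u,0) = ½ ∫₀ᵘ q(s) ds`, `H(0,v) = 0` on the domain above.
Here `Hv` is `∂H/∂v`; derivatives at boundary points are taken within the domain. -/
structure IsGoursatSolution {a : ℝ} (ha : 0 < a) (q : CSpace a) (H : ℝ → ℝ → ℂ) : Prop where
  continuousOn : ContinuousOn (Function.uncurry H) (goursatDomain a)
  equation : ∃ Hv : ℝ → ℝ → ℂ, ∀ u v : ℝ, (u, v) ∈ goursatDomain a →
    HasDerivWithinAt (fun v' => H u v') (Hv u v) {v' | (u, v') ∈ goursatDomain a} v ∧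
    HasDerivWithinAt (fun u' => Hv u' v) (onReal ha q (u + v) * H u v)
      {u' | (u', v) ∈ goursatDomain a} u
  on_u_axis : ∀ u ∈ Icc (-a) a, H u 0 = 1 / 2 * ∫ s in (0 : ℝ)..u, onReal ha q s
  on_v_axis : ∀ v ∈ Icc (-a) a, H 0 v = 0

/-- `K(x,t) = H((x+t)/2, (x-t)/2)`. -/
noncomputable def kernelK (H : ℝ → ℝ → ℂ) (x t : ℝ) : ℂ := H ((x + t) / 2) ((x - t) / 2)

/-- `𝐊(x,t;h) = h/2 + K(x,t) + (h/2) ∫ₜˣ (K(x,s) - K(x,-s)) ds`. -/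
noncomputable def kernelKh (H : ℝ → ℝ → ℂ) (h : ℂ) (x t : ℝ) : ℂ :=
  h / 2 + kernelK H x t + h / 2 * ∫ s in t..x, (kernelK H x s - kernelK H x (-s))

/-- `𝐓_h u(x) = u(x) + ∫_{-x}^{x} 𝐊(x,t;h) u(t) dt` (an oriented integral, also for `x < 0`). -/
noncomputable def operatorTh {a : ℝ} (ha : 0 < a) (H : ℝ → ℝ → ℂ) (h : ℂ) (u : CSpace a)
    (x : Icc (-a) a) : ℂ :=
  u x + ∫ t in (-(x : ℝ))..(x : ℝ), kernelKh H h x t * onReal ha u t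

end Transmutation

namespace Transmutation

open Set MeasureTheory Filter Topology

/-! Integrating the Goursat problem over the rectangle with opposite corners `0` and `(u,v)` gives a
Volterra equation, `H = ½∫q + ∬ q(s+t) H`. Bounds of the form `|u|^n/n!` show that some power of its
operator has norm below one (`isUnit_one_add_of_volterra`), whence existence; the same iteration
applied to a difference of solutions gives uniqueness. `T_h` is the identity plus a Volterra
operator in one variable, so it is invertible for the same reason.

For the intertwining relation, `T_h = T_0 S_h` (`integral_kernelKh_mul`), and `S_h` commutes with
`d²/dx²`, which leaves `T_0`. In characteristic coordinates its integral term is `2∫₀ˣ H(x-t,t)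
u(x-2t) dt`. Differentiating once through the first argument of `H` and once through the second
involves only `H_u`, `H_v` and `H_uv`, never `H_uu`, which would call for `q'`
(`exists_second_deriv_integral_kernelK`). Integration by parts along the characteristic restores the
term with `u''`, and `H_uv = q(x) H` there because the arguments add up to `x`.

One-sided derivatives are kept out of the calculus by extending `q`, the density `p = H_uv` and `u`
from `[-a,a]` to the whole line or plane. -/

/-! ### Integrals depending on a parameter -/

theorem hasDerivAt_integral_param {F F' : ℝ → ℝ → ℂ} (hF : Continuous (Function.uncurry F))
    (hF' : Continuous (Function.uncurry F')) (hd : ∀ x t, HasDerivAt (fun y => F y t) (F' x t) x)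
    (a b x : ℝ) :
    HasDerivAt (fun y => ∫ t in a..b, F y t) (∫ t in a..b, F' x t) x := by
  obtain ⟨M, hM⟩ := ((isCompact_closedBall x 1).prod (isCompact_uIcc (a := a) (b := b))).bddAbove_image
    hF'.norm.continuousOn
  have hsec : ∀ {f : ℝ → ℝ → ℂ}, Continuous (Function.uncurry f) → ∀ y, Continuous (f y) :=
    fun h y => h.comp (Continuous.prodMk_right y)
  refine (intervalIntegral.hasDerivAt_integral_of_dominated_loc_of_deriv_le (bound := fun _ => M)
    (Metric.closedBall_mem_nhds x one_pos)
    (.of_forall fun y => (hsec hF y).aestronglyMeasurable)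
    ((hsec hF x).intervalIntegrable _ _) (hsec hF' x).aestronglyMeasurable ?_
    intervalIntegrable_const ?_).2
  · exact .of_forall fun t ht y hy => hM ⟨(y, t), ⟨hy, uIoc_subset_uIcc ht⟩, rfl⟩
  · exact .of_forall fun t _ y _ => hd y t

/-- Continuous partial derivatives give strict differentiability of `f` in both variables, hence the
chain rule along a curve. -/
theorem hasDerivAt_comp_of_partial {f f₁ f₂ : ℝ → ℝ → ℂ} (h₁ : Continuous (Function.uncurry f₁))
    (h₂ : Continuous (Function.uncurry f₂)) (hd₁ : ∀ x y, HasDerivAt (fun s => f s y) (f₁ x y) x)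
    (hd₂ : ∀ x y, HasDerivAt (fun s => f x s) (f₂ x y) y) {α β : ℝ → ℝ} {α' β' t : ℝ}
    (hα : HasDerivAt α α' t) (hβ : HasDerivAt β β' t) :
    HasDerivAt (fun s => f (α s) (β s)) (α' • f₁ (α t) (β t) + β' • f₂ (α t) (β t)) t := by
  have h := hasStrictFDerivAt_uncurry_coprod (u := (α t, β t)) (f := f)
    (f₁ := fun y z => ContinuousLinearMap.toSpanSingleton ℝ (f₁ y z))
    (f₂ := fun y z => ContinuousLinearMap.toSpanSingleton ℝ (f₂ y z))
    (.of_forall fun p => (hd₁ p.1 p.2).hasFDerivAt)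
    (.of_forall fun p => (hd₂ p.1 p.2).hasFDerivAt)
    ((ContinuousLinearMap.toSpanSingletonCLE (𝕜 := ℝ) (E := ℂ)).continuous.comp h₁).continuousAt
    ((ContinuousLinearMap.toSpanSingletonCLE (𝕜 := ℝ) (E := ℂ)).continuous.comp h₂).continuousAt
  have h2 := h.hasFDerivAt.comp_hasDerivAt (f := fun s => (α s, β s)) t (hα.prodMk hβ)
  convert! h2 using 1

/-- Leibniz' rule for an integral whose upper end moves with the parameter. -/
theorem hasDerivAt_integral_param_right {F F' : ℝ → ℝ → ℂ} (hF : Continuous (Function.uncurry F))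
    (hF' : Continuous (Function.uncurry F')) (hd : ∀ x t, HasDerivAt (fun y => F y t) (F' x t) x)
    (x : ℝ) :
    HasDerivAt (fun y => ∫ t in (0 : ℝ)..y, F y t) (F x x + ∫ t in (0 : ℝ)..x, F' x t) x := by
  have h := hasDerivAt_comp_of_partial (f := fun y z => ∫ t in (0 : ℝ)..z, F y t)
    (f₁ := fun y z => ∫ t in (0 : ℝ)..z, F' y t) (f₂ := F)
    (intervalIntegral.continuous_parametric_primitive_of_continuous hF') hF
    (fun y z => hasDerivAt_integral_param hF hF' hd 0 z y)
    (fun y z => (Continuous.integral_hasStrictDerivAt (f := F y)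
      (hF.comp (Continuous.prodMk_right y)) 0 z).hasDerivAt) (hasDerivAt_id' x) (hasDerivAt_id' x)
  simpa [add_comm] using h

/-- Derivative of an integral along the characteristic segment `s + t = x`, by means of the
derivative in the first variable. -/
theorem hasDerivAt_integral_antidiagonal_fst {G G' : ℝ → ℝ → ℂ}
    (hG : Continuous (Function.uncurry G)) (hG' : Continuous (Function.uncurry G'))
    (hd : ∀ s t, HasDerivAt (fun y => G y t) (G' s t) s) (x : ℝ) :
    HasDerivAt (fun y => ∫ t in (0 : ℝ)..y, G (y - t) t)
      (G 0 x + ∫ t in (0 : ℝ)..x, G' (x - t) t) x := by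
  have hc : Continuous fun p : ℝ × ℝ => (p.1 - p.2, p.2) := by fun_prop
  have := hasDerivAt_integral_param_right (F := fun y t => G (y - t) t)
    (F' := fun y t => G' (y - t) t) (hG.comp hc) (hG'.comp hc)
    (fun y t => (hd (y - t) t).comp_sub_const y t) x
  simpa using this

/-- Derivative of an integral along the characteristic segment `s + t = x`, by means of the
derivative in the second variable. -/
theorem hasDerivAt_integral_antidiagonal_snd {G G' : ℝ → ℝ → ℂ}
    (hG : Continuous (Function.uncurry G)) (hG' : Continuous (Function.uncurry G'))
    (hd : ∀ s t, HasDerivAt (fun y => G s y) (G' s t) t) (x : ℝ) :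
    HasDerivAt (fun y => ∫ t in (0 : ℝ)..y, G (y - t) t)
      (G x 0 + ∫ t in (0 : ℝ)..x, G' (x - t) t) x := by
  have hflip : ∀ (f : ℝ → ℝ → ℂ) (y : ℝ),
      ∫ t in (0 : ℝ)..y, f (y - t) t = ∫ t in (0 : ℝ)..y, f t (y - t) := fun f y => by
    simpa using intervalIntegral.integral_comp_sub_left (a := 0) (b := y) (fun t => f t (y - t)) y
  simp_rw [hflip]
  exact hasDerivAt_integral_antidiagonal_fst (G := fun t s => G s t) (G' := fun t s => G' s t)
    (hG.comp continuous_swap) (hG'.comp continuous_swap) (fun s t => hd t s) x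

section DoubleIntegral

variable {p : ℝ → ℝ → ℂ}

theorem continuous_inner_integral (hp : Continuous (Function.uncurry p)) :
    Continuous (Function.uncurry fun u v => ∫ t in (0 : ℝ)..v, p u t) :=
  intervalIntegral.continuous_parametric_primitive_of_continuous hp

theorem continuous_outer_integral (hp : Continuous (Function.uncurry p)) :
    Continuous (Function.uncurry fun u v => ∫ s in (0 : ℝ)..u, p s v) :=
  (intervalIntegral.continuous_parametric_primitive_of_continuous (f := fun v s => p s v)
    (hp.comp continuous_swap)).comp continuous_swap

theorem continuous_double_integral (hp : Continuous (Function.uncurry p)) :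
    Continuous (Function.uncurry fun u v => ∫ s in (0 : ℝ)..u, ∫ t in (0 : ℝ)..v, p s t) :=
  continuous_outer_integral (continuous_inner_integral hp)

theorem hasDerivAt_double_integral_fst (hp : Continuous (Function.uncurry p)) (u v : ℝ) :
    HasDerivAt (fun u' => ∫ s in (0 : ℝ)..u', ∫ t in (0 : ℝ)..v, p s t)
      (∫ t in (0 : ℝ)..v, p u t) u :=
  (Continuous.integral_hasStrictDerivAt (f := fun s => ∫ t in (0 : ℝ)..v, p s t)
    ((continuous_inner_integral hp).comp (Continuous.prodMk_left v)) 0 u).hasDerivAt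

theorem hasDerivAt_double_integral_snd (hp : Continuous (Function.uncurry p)) (u v : ℝ) :
    HasDerivAt (fun v' => ∫ s in (0 : ℝ)..u, ∫ t in (0 : ℝ)..v', p s t)
      (∫ s in (0 : ℝ)..u, p s v) v :=
  hasDerivAt_integral_param (F := fun v s => ∫ t in (0 : ℝ)..v, p s t) (F' := fun v s => p s v)
    ((continuous_inner_integral hp).comp continuous_swap) (hp.comp continuous_swap)
    (fun v s => (Continuous.integral_hasStrictDerivAt (f := p s)
      (hp.comp (Continuous.prodMk_right s)) 0 v).hasDerivAt) 0 u v

end DoubleIntegral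

/-! ### Invertibility of Volterra operators -/

/-- If some power of `W` has norm less than one, then `1 + W` is invertible. -/
theorem isUnit_one_add_of_norm_pow_lt_one {R : Type*} [NormedRing R] [CompleteSpace R]
    {W : R} {n : ℕ} (h : ‖W ^ n‖ < 1) : IsUnit (1 + W) := by
  have h1 : IsUnit (1 - (-W) ^ n) := by
    apply isUnit_one_sub_of_norm_lt_one
    rcases n.even_or_odd with h' | h' <;> simpa [h'.neg_pow] using h
  have h2 : Commute (1 - -W) (∑ i ∈ Finset.range n, (-W) ^ i) :=
    .sum_right _ _ _ fun i _ => ((Commute.one_left _).sub_left (.refl _)).pow_right i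
  -- `1 - (-W)^n` is a product of two commuting factors, one of them `1 + W`; if the product is a
  -- unit, so are both factors.
  rw [← mul_neg_geom_sum, h2.isUnit_mul_iff] at h1
  simpa using h1.1

/-- A Volterra type operator: if applying `W` raises by one the order of vanishing, in the sense
of a weight `φ`, with the constants of repeated integration, then `1 + W` is invertible. -/
theorem isUnit_one_add_of_volterra {X : Type*} [TopologicalSpace X] [CompactSpace X] [Nonempty X]
    (W : C(X, ℂ) →L[ℂ] C(X, ℂ)) (φ : X → ℝ) (A C : ℝ) (hφ : ∀ x, 0 ≤ φ x) (hφA : ∀ x, φ x ≤ A)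
    (hW : ∀ (f : C(X, ℂ)) (c : ℝ) (n : ℕ), 0 ≤ c → (∀ x, ‖f x‖ ≤ c * (φ x ^ n / n.factorial)) →
      ∀ x, ‖W f x‖ ≤ c * C * (φ x ^ (n + 1) / (n + 1).factorial)) (hC : 0 ≤ C) :
    IsUnit (1 + W) := by
  have hpow : ∀ (n : ℕ) (f : C(X, ℂ)) (x : X),
      ‖(W ^ n) f x‖ ≤ ‖f‖ * C ^ n * (φ x ^ n / n.factorial) := by
    intro n f
    induction n with
    | zero => intro x; simpa using f.norm_coe_le_norm x
    | succ n ih =>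
      intro x
      rw [pow_succ', mul_apply_eq_comp]
      refine (hW _ _ n (by positivity) ih x).trans_eq (by ring)
  have hlim := FloorSemiring.tendsto_pow_div_factorial_atTop (C * A)
  obtain ⟨n, hn⟩ := (hlim.eventually (gt_mem_nhds one_pos)).exists
  suffices h : ‖W ^ n‖ ≤ (C * A) ^ n / n.factorial from
    isUnit_one_add_of_norm_pow_lt_one (R := C(X, ℂ) →L[ℂ] C(X, ℂ)) (h.trans_lt hn)
  obtain ⟨x₀⟩ := ‹Nonempty X›
  have hA : 0 ≤ A := (hφ x₀).trans (hφA x₀)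
  refine ContinuousLinearMap.opNorm_le_bound _ (by positivity) fun f => ?_
  refine (ContinuousMap.norm_le _ (by positivity)).2 fun x => (hpow n f x).trans ?_
  rw [mul_pow, mul_div_assoc, mul_comm (_ * _) ‖f‖, mul_assoc]
  have := hφ x
  gcongr
  exact hφA x

theorem norm_integral_le_pow_div_factorial {g : ℝ → ℂ} {x c : ℝ} {n : ℕ}
    (hg : ∀ t ∈ uIcc 0 x, ‖g t‖ ≤ c * (|t| ^ n / n.factorial)) :
    ‖∫ t in (0 : ℝ)..x, g t‖ ≤ c * (|x| ^ (n + 1) / (n + 1).factorial) := by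
  have key : ∀ {g : ℝ → ℂ} {x : ℝ}, 0 ≤ x →
      (∀ t ∈ Icc 0 x, ‖g t‖ ≤ c * (|t| ^ n / n.factorial)) →
      ‖∫ t in (0 : ℝ)..x, g t‖ ≤ c * (|x| ^ (n + 1) / (n + 1).factorial) := by
    intro g x hx hg
    have h : ‖∫ t in (0 : ℝ)..x, g t‖ ≤ ∫ t in (0 : ℝ)..x, c * (t ^ n / n.factorial) := by
      refine intervalIntegral.norm_integral_le_of_norm_le hx (.of_forall fun t ht => ?_)
        (Continuous.intervalIntegrable (by fun_prop) _ _)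
      simpa [abs_of_pos ht.1] using hg t (Ioc_subset_Icc_self ht)
    refine h.trans_eq ?_
    rw [intervalIntegral.integral_const_mul, intervalIntegral.integral_div, integral_pow,
      abs_of_nonneg hx, Nat.factorial_succ]
    have : (n.factorial : ℝ) ≠ 0 := by positivity
    push_cast
    field_simp
    simp
  rcases le_total 0 x with hx | hx
  · exact key hx (by simpa [uIcc_of_le hx] using hg)
  · have h := key (g := fun t => g (-t)) (neg_nonneg.2 hx) fun t ht => by
      simpa using hg (-t) (by rw [uIcc_of_ge hx]; constructor <;> linarith [ht.1, ht.2])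
    rw [intervalIntegral.integral_comp_neg, neg_neg, neg_zero, intervalIntegral.integral_symm,
      norm_neg, abs_neg] at h
    exact h

/-- Folding fixes the lower end at `0`, so that Volterra estimates and the fundamental theorem apply
directly, whatever the sign of `x`. -/
theorem integral_symmetric_eq {g : ℝ → ℂ} (hg : Continuous g) (x : ℝ) :
    ∫ t in (-x)..x, g t = ∫ t in (0 : ℝ)..x, (g t + g (-t)) := by
  have hi : ∀ a b, IntervalIntegrable g volume a b := fun a b => hg.intervalIntegrable a b
  rw [intervalIntegral.integral_add (hi _ _) (Continuous.intervalIntegrable (by fun_prop) _ _),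
    intervalIntegral.integral_comp_neg, neg_zero, add_comm,
    intervalIntegral.integral_add_adjacent_intervals (hi _ _) (hi _ _)]

section

variable {a : ℝ} (ha : 0 < a)

theorem continuous_onReal (u : CSpace a) : Continuous (onReal ha u) :=
  u.continuous.Icc_extend'

theorem onReal_of_mem (u : CSpace a) {x : ℝ} (hx : x ∈ Icc (-a) a) : onReal ha u x = u ⟨x, hx⟩ :=
  IccExtend_of_mem _ _ hx

theorem onReal_coe (u : CSpace a) (x : Icc (-a) a) : onReal ha u x = u x :=
  IccExtend_val _ _ x

theorem norm_onReal_le (u : CSpace a) (x : ℝ) : ‖onReal ha u x‖ ≤ ‖u‖ :=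
  u.norm_coe_le_norm _

theorem mem_Icc_of_mem_uIcc {x t : ℝ} (hx : x ∈ Icc (-a) a) (ht : t ∈ uIcc (-x) x) :
    t ∈ Icc (-a) a :=
  uIcc_subset_Icc ⟨by linarith [hx.2], by linarith [hx.1]⟩ hx ht

/-- The Volterra operator with a continuous kernel on `|t| ≤ |x| ≤ a`; it is a bounded operator on
`C[-a,a]` and `1` plus it is invertible. -/
theorem exists_volterra {k : ℝ → ℝ → ℂ} (hk : Continuous (Function.uncurry k)) :
    ∃ W : CSpace a →L[ℂ] CSpace a,
      (∀ u (x : Icc (-a) a), W u x = ∫ t in (-(x : ℝ))..(x : ℝ), k x t * onReal ha u t) ∧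
      IsUnit (1 + W) := by
  have hsec : ∀ x, Continuous (k x) := fun x => hk.comp (Continuous.prodMk_right x)
  have hint : ∀ (u : CSpace a) x, Continuous fun t => k x t * onReal ha u t := fun u x =>
    (hsec x).mul (continuous_onReal ha u)
  obtain ⟨M, hM⟩ := ((isCompact_Icc (a := -a) (b := a)).prod
    (isCompact_Icc (a := -a) (b := a))).bddAbove_image hk.norm.continuousOn
  replace hM : ∀ x ∈ Icc (-a) a, ∀ t ∈ Icc (-a) a, ‖k x t‖ ≤ M := fun x hx t ht =>
    hM ⟨(x, t), ⟨hx, ht⟩, rfl⟩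
  have h0 : (0 : ℝ) ∈ Icc (-a) a := ⟨by linarith, ha.le⟩
  have hM0 : 0 ≤ M := (norm_nonneg _).trans (hM 0 h0 0 h0)
  have hbound : ∀ (f : CSpace a) (c : ℝ) (n : ℕ), 0 ≤ c →
      (∀ x : Icc (-a) a, ‖f x‖ ≤ c * (|(x : ℝ)| ^ n / n.factorial)) →
      ∀ x : Icc (-a) a, ‖∫ t in (-(x : ℝ))..(x : ℝ), k x t * onReal ha f t‖ ≤
        c * (2 * M) * (|(x : ℝ)| ^ (n + 1) / (n + 1).factorial) := by
    intro f c n hc hf x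
    -- After folding, the points `t` and `-t` each contribute `M`: hence the constant `2 * M`.
    rw [integral_symmetric_eq (hint f x)]
    refine norm_integral_le_pow_div_factorial fun t ht => ?_
    have hb : ∀ s ∈ Icc (-a) a,
        ‖k x s * onReal ha f s‖ ≤ M * (c * (|s| ^ n / n.factorial)) := fun s hs => by
      rw [norm_mul, onReal_of_mem ha f hs]
      exact mul_le_mul (hM x x.2 s hs) (hf ⟨s, hs⟩) (norm_nonneg _) hM0
    have htm : t ∈ Icc (-a) a := uIcc_subset_Icc h0 x.2 ht
    have h1 := hb t htm
    have h2 := hb (-t) ⟨by linarith [htm.2], by linarith [htm.1]⟩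
    rw [abs_neg] at h2
    refine (norm_add_le _ _).trans ((add_le_add h1 h2).trans_eq (by ring))
  let L : CSpace a →ₗ[ℂ] CSpace a :=
    { toFun := fun u =>
        { toFun := fun x => ∫ t in (-(x : ℝ))..(x : ℝ), k x t * onReal ha u t
          continuous_toFun := by
            have h1 : Continuous (Function.uncurry fun x t => k x t * onReal ha u t) :=
              hk.mul ((continuous_onReal ha u).comp continuous_snd)
            have h2 : ∀ x : ℝ, ∫ t in (-x)..x, k x t * onReal ha u t =
                (∫ t in (0 : ℝ)..x, k x t * onReal ha u t) -
                  ∫ t in (0 : ℝ)..(-x), k x t * onReal ha u t := fun x =>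
              (intervalIntegral.integral_interval_sub_left ((hint u x).intervalIntegrable _ _)
                ((hint u x).intervalIntegrable _ _)).symm
            simp_rw [h2]
            exact ((intervalIntegral.continuous_parametric_intervalIntegral_of_continuous h1
                continuous_id).sub
              (intervalIntegral.continuous_parametric_intervalIntegral_of_continuous h1
                continuous_neg)).comp continuous_subtype_val }
      map_add' := fun u v => by
        ext x
        simp only [ContinuousMap.coe_mk, ContinuousMap.add_apply, onReal_add, Pi.add_apply, mul_add]
        exact intervalIntegral.integral_add ((hint u x).intervalIntegrable _ _)
          ((hint v x).intervalIntegrable _ _)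
      map_smul' := fun c u => by
        ext x
        simp only [ContinuousMap.coe_mk, ContinuousMap.smul_apply, onReal_smul, Pi.smul_apply,
          RingHom.id_apply, smul_eq_mul, ← intervalIntegral.integral_const_mul]
        congr 1 with t
        ring }
  have hLb : ∀ u, ‖L u‖ ≤ 2 * M * a * ‖u‖ := fun u => by
    refine (ContinuousMap.norm_le _ (by positivity)).2 fun x => ?_
    -- The case `n = 0` of the Volterra estimate is the operator bound.
    have := hbound u ‖u‖ 0 (norm_nonneg _) (fun y => by simpa using u.norm_coe_le_norm y) x
    refine this.trans ?_
    have hx : |(x : ℝ)| ≤ a := abs_le.2 x.2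
    simp only [zero_add, pow_one, Nat.factorial_one, Nat.cast_one, div_one]
    rw [mul_comm ‖u‖, mul_right_comm]
    gcongr
  have : Nonempty (Icc (-a) a) := ⟨⟨0, h0⟩⟩
  exact ⟨L.mkContinuous _ hLb, fun u x => rfl,
    isUnit_one_add_of_volterra _ (fun x => |(x : ℝ)|) a (2 * M) (fun x => abs_nonneg _)
      (fun x => abs_le.2 x.2) hbound (by positivity)⟩

/-! ### The integral equation of the Goursat problem -/

/-- Solution of the integral equation equivalent to the Goursat problem. -/
theorem exists_goursat_density (q : CSpace a) :
    ∃ p : ℝ → ℝ → ℂ, Continuous (Function.uncurry p) ∧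
      ∀ u ∈ Icc (-a) a, ∀ v ∈ Icc (-a) a, p u v = onReal ha q (u + v) *
        (1 / 2 * (∫ s in (0 : ℝ)..u, onReal ha q s) +
          ∫ s in (0 : ℝ)..u, ∫ t in (0 : ℝ)..v, p s t) := by
  have h0 : (0 : ℝ) ∈ Icc (-a) a := ⟨by linarith, ha.le⟩
  let I := Icc (-a) a
  -- The equation is solved on the square `[-a,a]²`, and clamping the coordinates makes the density
  -- `P F` continuous on the whole plane.
  let π : ℝ → I := projIcc (-a) a (neg_le_self ha.le)
  have hπ : Continuous π := continuous_projIcc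
  have hπm : ∀ x (hx : x ∈ Icc (-a) a), π x = ⟨x, hx⟩ := fun x hx => projIcc_of_mem _ hx
  have hqc := continuous_onReal ha q
  let P : C(I × I, ℂ) → ℝ → ℝ → ℂ := fun F s t => onReal ha q (s + t) * F (π s, π t)
  have hP : ∀ F, Continuous (Function.uncurry (P F)) := fun F => by
    simp only [P, Function.uncurry_def]
    fun_prop
  -- Only powers of `|u|` are tracked; the integral in `v` merely costs a factor `a`. The minus sign
  -- fits the form `1 + W` of the invertibility criterion.
  have hb : ∀ (F : C(I × I, ℂ)) (c : ℝ) (n : ℕ),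
      (∀ x : I × I, ‖F x‖ ≤ c * (|(x.1 : ℝ)| ^ n / n.factorial)) → ∀ x : I × I,
      ‖-∫ s in (0 : ℝ)..x.1, ∫ t in (0 : ℝ)..x.2, P F s t‖ ≤
        c * (‖q‖ * a) * (|(x.1 : ℝ)| ^ (n + 1) / (n + 1).factorial) := by
    intro F c n hF x
    rw [norm_neg]
    refine norm_integral_le_pow_div_factorial fun s hs => ?_
    have hsm : s ∈ Icc (-a) a := uIcc_subset_Icc h0 x.1.2 hs
    have hpos : 0 ≤ c * (|s| ^ n / n.factorial) := by
      have := hF (⟨s, hsm⟩, x.2)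
      exact (norm_nonneg _).trans this
    have h1 := intervalIntegral.norm_integral_le_of_norm_le_const
      (a := 0) (b := (x.2 : ℝ)) (f := P F s) (C := ‖q‖ * (c * (|s| ^ n / n.factorial)))
      fun t _ => by
        rw [norm_mul]
        gcongr
        · exact norm_onReal_le ha q _
        · rw [hπm s hsm]
          exact hF (⟨s, hsm⟩, π t)
    refine h1.trans ?_
    rw [sub_zero]
    calc ‖q‖ * (c * (|s| ^ n / n.factorial)) * |(x.2 : ℝ)|
        ≤ ‖q‖ * (c * (|s| ^ n / n.factorial)) * a := by gcongr; exact abs_le.2 x.2.2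
      _ = _ := by ring
  let L : C(I × I, ℂ) →ₗ[ℂ] C(I × I, ℂ) :=
    { toFun := fun F =>
        { toFun := fun x => -∫ s in (0 : ℝ)..x.1, ∫ t in (0 : ℝ)..x.2, P F s t
          continuous_toFun := ((continuous_double_integral (hP F)).comp
            (continuous_subtype_val.prodMap continuous_subtype_val)).neg }
      map_add' := fun F F' => by
        ext x
        have h : ∀ s t, P (F + F') s t = P F s t + P F' s t := fun s t => mul_add _ _ _
        have h' : ∀ s, ∫ t in (0 : ℝ)..x.2, P (F + F') s t =
            (∫ t in (0 : ℝ)..x.2, P F s t) + ∫ t in (0 : ℝ)..x.2, P F' s t := fun s => by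
          simp_rw [h]
          exact intervalIntegral.integral_add
            (((hP F).comp (Continuous.prodMk_right s)).intervalIntegrable _ _)
            (((hP F').comp (Continuous.prodMk_right s)).intervalIntegrable _ _)
        change -(∫ s in (0 : ℝ)..x.1, ∫ t in (0 : ℝ)..x.2, P (F + F') s t) =
          -(∫ s in (0 : ℝ)..x.1, ∫ t in (0 : ℝ)..x.2, P F s t) +
            -∫ s in (0 : ℝ)..x.1, ∫ t in (0 : ℝ)..x.2, P F' s t
        simp only [h', ← neg_add]
        congr 1
        exact intervalIntegral.integral_add
          (((continuous_inner_integral (hP F)).comp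
            (Continuous.prodMk_left (x.2 : ℝ))).intervalIntegrable _ _)
          (((continuous_inner_integral (hP F')).comp
            (Continuous.prodMk_left (x.2 : ℝ))).intervalIntegrable _ _)
      map_smul' := fun c F => by
        ext x
        have h : ∀ s t, P (c • F) s t = c * P F s t := fun s t => mul_left_comm _ _ _
        change -(∫ s in (0 : ℝ)..x.1, ∫ t in (0 : ℝ)..x.2, P (c • F) s t) =
          c * -∫ s in (0 : ℝ)..x.1, ∫ t in (0 : ℝ)..x.2, P F s t
        simp only [h, intervalIntegral.integral_const_mul, mul_neg] }
  have hLb : ∀ F, ‖L F‖ ≤ ‖q‖ * a * a * ‖F‖ := fun F => by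
    refine (ContinuousMap.norm_le _ (by positivity)).2 fun x => ?_
    have := hb F ‖F‖ 0 (fun y => by simpa using F.norm_coe_le_norm y) x
    refine this.trans ?_
    have hx : |(x.1 : ℝ)| ≤ a := abs_le.2 x.1.2
    simp only [zero_add, pow_one, Nat.factorial_one, Nat.cast_one, div_one]
    rw [mul_comm ‖F‖, mul_right_comm]
    gcongr
  have : Nonempty (I × I) := ⟨⟨⟨0, h0⟩, ⟨0, h0⟩⟩⟩
  obtain ⟨U, hU⟩ := isUnit_one_add_of_volterra (L.mkContinuous _ hLb)
    (fun x => |(x.1 : ℝ)|) a (‖q‖ * a) (fun x => abs_nonneg _) (fun x => abs_le.2 x.1.2)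
    (fun F c n _ => hb F c n) (by positivity)
  let f₀ : C(I × I, ℂ) :=
    { toFun := fun x => 1 / 2 * ∫ s in (0 : ℝ)..x.1, onReal ha q s
      continuous_toFun := by
        have : Continuous fun u : ℝ => ∫ s in (0 : ℝ)..u, onReal ha q s :=
          intervalIntegral.continuous_primitive (fun _ _ => hqc.intervalIntegrable _ _) 0
        fun_prop }
  obtain ⟨F, hF⟩ := (ContinuousLinearEquiv.ofUnit U).surjective f₀
  replace hF : F + L F = f₀ := by
    rw [← hF]
    change F + L F = (U : C(I × I, ℂ) →L[ℂ] C(I × I, ℂ)) F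
    rw [hU]
    rfl
  refine ⟨P F, hP F, fun u hu v hv => ?_⟩
  have h := congrArg (fun f : C(I × I, ℂ) => f (⟨u, hu⟩, ⟨v, hv⟩)) hF
  change F (⟨u, hu⟩, ⟨v, hv⟩) + -(∫ s in (0 : ℝ)..u, ∫ t in (0 : ℝ)..v, P F s t) =
    1 / 2 * ∫ s in (0 : ℝ)..u, onReal ha q s at h
  rw [← h, neg_add_cancel_right]
  simp only [P, hπm u hu, hπm v hv]

end

/-! ### Uniqueness for the Goursat problem -/

/-- A mean value inequality replaces integration here, since `∂H/∂v` of an arbitrary solution is not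
assumed continuous. Negative `x` is reflected to positive `x`. -/
theorem norm_le_pow_div_factorial_of_deriv {f f' : ℝ → ℂ} {x c : ℝ} {n : ℕ}
    (hf : ∀ s ∈ uIcc 0 x, HasDerivWithinAt f (f' s) (uIcc 0 x) s) (h0 : f 0 = 0)
    (hb : ∀ s ∈ uIcc 0 x, ‖f' s‖ ≤ c * (|s| ^ n / n.factorial)) :
    ‖f x‖ ≤ c * (|x| ^ (n + 1) / (n + 1).factorial) := by
  have key : ∀ {f f' : ℝ → ℂ} {x : ℝ}, 0 ≤ x →
      (∀ s ∈ Icc 0 x, HasDerivWithinAt f (f' s) (Icc 0 x) s) → f 0 = 0 →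
      (∀ s ∈ Icc 0 x, ‖f' s‖ ≤ c * (|s| ^ n / n.factorial)) →
      ‖f x‖ ≤ c * (|x| ^ (n + 1) / (n + 1).factorial) := by
    intro f f' x hx hf h0 hb
    have := image_norm_le_of_norm_deriv_right_le_deriv_boundary (a := 0) (b := x) (f := f)
      (f' := f') (B := fun t => c * (t ^ (n + 1) / (n + 1).factorial))
      (B' := fun t => c * (t ^ n / n.factorial))
      (fun s hs => (hf s hs).continuousWithinAt)
      (fun s hs => (hf s (Ico_subset_Icc_self hs)).mono_of_mem_nhdsWithin
        (mem_of_superset (Icc_mem_nhdsGE hs.2) (Icc_subset_Icc_left hs.1)))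
      (by simp [h0])
      (fun t => by
        refine (((hasDerivAt_pow (n + 1) t).div_const _).const_mul c).congr_deriv ?_
        rw [Nat.factorial_succ]
        have : (n.factorial : ℝ) ≠ 0 := by positivity
        push_cast
        field_simp)
      (fun s hs => by simpa [abs_of_nonneg hs.1] using hb s (Ico_subset_Icc_self hs))
      (right_mem_Icc.2 hx)
    simpa [abs_of_nonneg hx] using this
  rcases le_total 0 x with hx | hx
  · rw [uIcc_of_le hx] at hf hb
    exact key hx hf h0 hb
  · rw [uIcc_of_ge hx] at hf hb
    have hm : ∀ s ∈ Icc 0 (-x), -s ∈ Icc x 0 := fun s hs => ⟨by linarith [hs.2], by linarith [hs.1]⟩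
    have := key (f := fun s => f (-s)) (f' := fun s => -f' (-s)) (neg_nonneg.2 hx)
      (fun s hs => by
        have := (hf (-s) (hm s hs)).scomp s (hasDerivAt_neg s).hasDerivWithinAt (t' := Icc x 0) hm
        simpa [Function.comp_def] using! this)
      (by simpa using h0) (fun s hs => by simpa using hb (-s) (hm s hs))
    simpa using this

section

variable {a : ℝ} (ha : 0 < a)

/-- Since `u` and `v` do not have opposite signs, moving each towards `0` cannot increase `|u + v|`.
This keeps integration from the axes inside the domain. -/
theorem mem_goursatDomain_of_mem_uIcc {u v s t : ℝ} (h : (u, v) ∈ goursatDomain a)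
    (hs : s ∈ uIcc 0 u) (ht : t ∈ uIcc 0 v) : (s, t) ∈ goursatDomain a := by
  obtain ⟨h1, h2⟩ := h
  simp only at h1 h2
  rw [abs_le] at h2
  rw [goursatDomain, mem_ofPred_eq, abs_le]
  dsimp only
  rcases mul_nonneg_iff.1 h1 with ⟨hu, hv⟩ | ⟨hu, hv⟩
  · rw [uIcc_of_le hu] at hs
    rw [uIcc_of_le hv] at ht
    exact ⟨mul_nonneg hs.1 ht.1, by linarith [hs.1, ht.1], by linarith [hs.2, ht.2]⟩
  · rw [uIcc_of_ge hu] at hs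
    rw [uIcc_of_ge hv] at ht
    exact ⟨mul_nonneg_of_nonpos_of_nonpos hs.2 ht.2, by linarith [hs.1, ht.1],
      by linarith [hs.2, ht.2]⟩

theorem mem_Icc_of_mem_goursatDomain {u v : ℝ} (h : (u, v) ∈ goursatDomain a) :
    u ∈ Icc (-a) a ∧ v ∈ Icc (-a) a := by
  have hu := (mem_goursatDomain_of_mem_uIcc h right_mem_uIcc left_mem_uIcc).2
  have hv := (mem_goursatDomain_of_mem_uIcc h left_mem_uIcc right_mem_uIcc).2
  simp only [add_zero, zero_add] at hu hv
  exact ⟨abs_le.1 hu, abs_le.1 hv⟩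

theorem isCompact_goursatDomain (a : ℝ) : IsCompact (goursatDomain a) := by
  refine ((isCompact_Icc (a := -a) (b := a)).prod
    (isCompact_Icc (a := -a) (b := a))).of_isClosed_subset ?_
    fun p hp => mem_Icc_of_mem_goursatDomain hp
  exact (isClosed_le (f := fun _ : ℝ × ℝ => (0 : ℝ)) (g := fun p => p.1 * p.2) (by fun_prop)
    (by fun_prop)).inter (isClosed_le (f := fun p : ℝ × ℝ => |p.1 + p.2|) (g := fun _ => a)
    (by fun_prop) (by fun_prop))

theorem zero_mem_goursatDomain_iff {v : ℝ} : (0, v) ∈ goursatDomain a ↔ v ∈ Icc (-a) a := by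
  simp [goursatDomain, abs_le]

/-- The difference `w` satisfies `∂_u w_v = q w`, with `w_v = 0` on `u = 0` and `w = 0` on `v = 0`.
One integration in each variable raises the power of `|u|` in a bound for `w` by one, and the
factorials force `w = 0`. -/
theorem IsGoursatSolution.unique {q : CSpace a} {H H' : ℝ → ℝ → ℂ}
    (hH : IsGoursatSolution ha q H) (hH' : IsGoursatSolution ha q H') {u v : ℝ}
    (huv : (u, v) ∈ goursatDomain a) : H' u v = H u v := by
  obtain ⟨Hv, hHv⟩ := hH.equation
  obtain ⟨Hv', hHv'⟩ := hH'.equation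
  obtain ⟨C, hC⟩ := (isCompact_goursatDomain a).exists_bound_of_continuousOn
    (hH'.continuousOn.sub hH.continuousOn)
  replace hC : ∀ u v, (u, v) ∈ goursatDomain a → ‖H' u v - H u v‖ ≤ C := fun u v h => hC _ h
  have hC0 : 0 ≤ C := (norm_nonneg _).trans (hC _ _ huv)
  -- On `u = 0` the slice of the domain is all of `[-a,a]`, where derivatives are unique, so the
  -- condition `H(0,v) = 0` may be differentiated.
  have hzero : ∀ v, (0, v) ∈ goursatDomain a → Hv' 0 v - Hv 0 v = 0 := by
    intro v hv
    have hv' := zero_mem_goursatDomain_iff.1 hv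
    have hd := (hHv' 0 v hv).1.sub (hHv 0 v hv).1
    have hset : {v' | (0, v') ∈ goursatDomain a} = Icc (-a) a :=
      Set.ext fun _ => zero_mem_goursatDomain_iff
    rw [hset] at hd
    refine (uniqueDiffOn_seg ha v hv').eq_deriv _ hd ?_
    refine (hasDerivWithinAt_const v _ (0 : ℂ)).congr (fun y hy => ?_) ?_
    · simp [hH.on_v_axis y hy, hH'.on_v_axis y hy]
    · simp [hH.on_v_axis v hv', hH'.on_v_axis v hv']
  have hn : ∀ n : ℕ, ∀ u v, (u, v) ∈ goursatDomain a →
      ‖H' u v - H u v‖ ≤ C * (‖q‖ * a) ^ n * (|u| ^ n / n.factorial) := by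
    intro n
    induction n with
    | zero => simpa using hC
    | succ n ih =>
      intro u v huv
      have hWv : ∀ t ∈ uIcc 0 v, ‖Hv' u t - Hv u t‖ ≤
          ‖q‖ * (C * (‖q‖ * a) ^ n) * (|u| ^ (n + 1) / (n + 1).factorial) := by
        intro t ht
        refine norm_le_pow_div_factorial_of_deriv (f := fun s => Hv' s t - Hv s t)
          (f' := fun s => onReal ha q (s + t) * H' s t - onReal ha q (s + t) * H s t)
          (fun s hs => ?_) (hzero t (mem_goursatDomain_of_mem_uIcc huv left_mem_uIcc ht))
          fun s hs => ?_
        · have hst := mem_goursatDomain_of_mem_uIcc huv hs ht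
          exact ((hHv' s t hst).2.sub (hHv s t hst).2).mono
            fun y hy => mem_goursatDomain_of_mem_uIcc huv hy ht
        · have hst := mem_goursatDomain_of_mem_uIcc huv hs ht
          rw [← mul_sub, norm_mul, mul_assoc]
          exact mul_le_mul (norm_onReal_le ha q _) (ih s t hst) (norm_nonneg _) (norm_nonneg _)
      have h := norm_le_pow_div_factorial_of_deriv (n := 0) (f := fun t => H' u t - H u t)
        (f' := fun t => Hv' u t - Hv u t) (x := v)
        (fun t ht => by
          have hut := mem_goursatDomain_of_mem_uIcc huv right_mem_uIcc ht
          exact ((hHv' u t hut).1.sub (hHv u t hut).1).mono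
            fun y hy => mem_goursatDomain_of_mem_uIcc huv right_mem_uIcc hy)
        (by
          have hu := (mem_Icc_of_mem_goursatDomain huv).1
          simp [hH.on_u_axis u hu, hH'.on_u_axis u hu])
        (fun t ht => by simpa using hWv t ht)
      refine h.trans ?_
      have hv : |v| ≤ a := abs_le.2 (mem_Icc_of_mem_goursatDomain huv).2
      simp only [zero_add, pow_one, Nat.factorial_one, Nat.cast_one, div_one]
      calc _ ≤ ‖q‖ * (C * (‖q‖ * a) ^ n) * (|u| ^ (n + 1) / (n + 1).factorial) * a := by gcongr
        _ = _ := by ring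
  have hlim : Tendsto (fun n : ℕ => C * ((‖q‖ * a * |u|) ^ n / n.factorial)) atTop (𝓝 0) := by
    simpa using (FloorSemiring.tendsto_pow_div_factorial_atTop (‖q‖ * a * |u|)).const_mul C
  have h0 : ‖H' u v - H u v‖ ≤ 0 := ge_of_tendsto' hlim fun n =>
    (hn n u v huv).trans_eq (by rw [mul_pow _ |u|]; ring)
  exact sub_eq_zero.1 (norm_le_zero_iff.1 h0)

/-! ### Existence for the Goursat problem -/

/-- The function with `∂²H/∂u∂v = p` and the boundary values of the Goursat problem. -/
noncomputable def goursatFun (q : CSpace a) (p : ℝ → ℝ → ℂ) (u v : ℝ) : ℂ :=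
  1 / 2 * (∫ s in (0 : ℝ)..u, onReal ha q s) + ∫ s in (0 : ℝ)..u, ∫ t in (0 : ℝ)..v, p s t

variable {q : CSpace a} {p : ℝ → ℝ → ℂ}

theorem hasDerivAt_goursatFun_fst (hp : Continuous (Function.uncurry p)) (u v : ℝ) :
    HasDerivAt (fun u' => goursatFun ha q p u' v)
      (1 / 2 * onReal ha q u + ∫ t in (0 : ℝ)..v, p u t) u :=
  (((continuous_onReal ha q).integral_hasStrictDerivAt 0 u).hasDerivAt.const_mul _).add
    (hasDerivAt_double_integral_fst hp u v)

theorem hasDerivAt_goursatFun_snd (hp : Continuous (Function.uncurry p)) (u v : ℝ) :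
    HasDerivAt (fun v' => goursatFun ha q p u v') (∫ s in (0 : ℝ)..u, p s v) v :=
  (hasDerivAt_double_integral_snd hp u v).const_add _

theorem continuous_goursatFun (hp : Continuous (Function.uncurry p)) :
    Continuous (Function.uncurry (goursatFun ha q p)) := by
  have h : Continuous fun u : ℝ => ∫ s in (0 : ℝ)..u, onReal ha q s :=
    intervalIntegral.continuous_primitive
      (fun _ _ => (continuous_onReal ha q).intervalIntegrable _ _) 0
  exact (continuous_const.mul (h.comp continuous_fst)).add (continuous_double_integral hp)

theorem isGoursatSolution_goursatFun (hp : Continuous (Function.uncurry p))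
    (hpq : ∀ u ∈ Icc (-a) a, ∀ v ∈ Icc (-a) a,
      p u v = onReal ha q (u + v) * goursatFun ha q p u v) :
    IsGoursatSolution ha q (goursatFun ha q p) where
  continuousOn := (continuous_goursatFun ha hp).continuousOn
  equation := by
    refine ⟨fun u v => ∫ s in (0 : ℝ)..u, p s v, fun u v huv =>
      ⟨(hasDerivAt_goursatFun_snd ha hp u v).hasDerivWithinAt, ?_⟩⟩
    obtain ⟨hu, hv⟩ := mem_Icc_of_mem_goursatDomain huv
    rw [← hpq u hu v hv]
    exact (Continuous.integral_hasStrictDerivAt (f := fun s => p s v)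
      (hp.comp (Continuous.prodMk_left v)) 0 u).hasDerivAt.hasDerivWithinAt
  on_u_axis u _ := by simp [goursatFun]
  on_v_axis v _ := by simp [goursatFun]

end

/-! ### The second derivative for `h = 0` -/

/-- The substitution `t ↦ x - 2t` passes to characteristic coordinates, where the integral runs
along the segment of points with sum `x`. -/
theorem integral_kernelK_mul (H : ℝ → ℝ → ℂ) (f : ℝ → ℂ) (x : ℝ) :
    ∫ t in (-x)..x, kernelK H x t * f t =
      2 * ∫ t in (0 : ℝ)..x, H (x - t) t * f (x - 2 * t) := by
  have h := intervalIntegral.integral_comp_sub_mul (a := 0) (b := x)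
    (fun t => kernelK H x t * f t) (two_ne_zero (α := ℝ)) x
  have h1 : ∀ t, kernelK H x (x - 2 * t) = H (x - t) t := fun t => by
    unfold kernelK
    congr 1 <;> ring
  have h2 : x - 2 * x = -x := by ring
  simp only [h1, mul_zero, sub_zero, h2] at h
  rw [h, Complex.real_smul, ← mul_assoc]
  norm_num

section

variable {a : ℝ} (ha : 0 < a) {q : CSpace a} {p : ℝ → ℝ → ℂ}

/-- Second derivative of `x ↦ ∫_{-x}^{x} K(x,t) u(t) dt`, where `K` comes from a function `H` with
`∂²H/∂u∂v = p`. -/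
theorem exists_second_deriv_integral_kernelK (hp : Continuous (Function.uncurry p))
    {u u₁ u₂ : ℝ → ℂ} (hu : ∀ x, HasDerivAt u (u₁ x) x) (hu₁ : ∀ x, HasDerivAt u₁ (u₂ x) x)
    (hu₂ : Continuous u₂) :
    ∃ D : ℝ → ℂ, ∀ x,
      HasDerivAt (fun x => ∫ t in (-x)..x, kernelK (goursatFun ha q p) x t * u t) (D x) x ∧
      HasDerivAt D (onReal ha q x * u x + 2 * (∫ t in (0 : ℝ)..x, p (x - t) t * u (x - 2 * t)) +
        ∫ t in (-x)..x, kernelK (goursatFun ha q p) x t * u₂ t) x := by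
  set H := goursatFun ha q p with hH
  -- `A = H_u` and `B = H_v`.
  set A : ℝ → ℝ → ℂ := fun s t => 1 / 2 * onReal ha q s + ∫ t' in (0 : ℝ)..t, p s t' with hA
  set B : ℝ → ℝ → ℂ := fun s t => ∫ s' in (0 : ℝ)..s, p s' t with hB
  have hqc := continuous_onReal ha q
  have cu : Continuous u := continuous_iff_continuousAt.2 fun x => (hu x).continuousAt
  have cu₁ : Continuous u₁ := continuous_iff_continuousAt.2 fun x => (hu₁ x).continuousAt
  have cH : Continuous (Function.uncurry H) := continuous_goursatFun ha hp
  have cA : Continuous (Function.uncurry A) :=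
    (continuous_const.mul (hqc.comp continuous_fst)).add (continuous_inner_integral hp)
  have cB : Continuous (Function.uncurry B) := continuous_outer_integral hp
  have dA : ∀ s t, HasDerivAt (fun y => H y t) (A s t) s := hasDerivAt_goursatFun_fst ha hp
  have dB : ∀ s t, HasDerivAt (fun y => H s y) (B s t) t := hasDerivAt_goursatFun_snd ha hp
  have dA' : ∀ s t, HasDerivAt (fun y => A s y) (p s t) t := fun s t =>
    (Continuous.integral_hasStrictDerivAt (f := p s)
      (hp.comp (Continuous.prodMk_right s)) 0 t).hasDerivAt.const_add _
  have csub : Continuous fun z : ℝ × ℝ => z.1 - z.2 := by fun_prop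
  have c1 : Continuous (Function.uncurry fun s t => H s t * u (s - t)) := cH.mul (cu.comp csub)
  have c2 : Continuous (Function.uncurry fun s t => A s t * u (s - t) + H s t * u₁ (s - t)) :=
    (cA.mul (cu.comp csub)).add (cH.mul (cu₁.comp csub))
  have c3 : Continuous (Function.uncurry fun s t =>
      (p s t * u (s - t) - A s t * u₁ (s - t)) + (B s t * u₁ (s - t) - H s t * u₂ (s - t))) :=
    ((hp.mul (cu.comp csub)).sub (cA.mul (cu₁.comp csub))).add
      ((cB.mul (cu₁.comp csub)).sub (cH.mul (hu₂.comp csub)))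
  -- The first derivative falls on the first argument, the second on the other one, so that `A` is
  -- differentiated to `H_uv = p` and not to `H_uu`.
  have d1 := hasDerivAt_integral_antidiagonal_fst c1 c2 fun s t =>
    (dA s t).mul ((hu (s - t)).comp_sub_const s t)
  have d2 := hasDerivAt_integral_antidiagonal_snd c2 c3 fun s t => by
    refine (((dA' s t).mul ((hu (s - t)).comp_const_sub s t)).add
      ((dB s t).mul ((hu₁ (s - t)).comp_const_sub s t))).congr_deriv ?_
    ring
  have hsub : ∀ x t : ℝ, x - t - t = x - 2 * t := fun x t => by ring
  simp only [hsub, sub_zero] at d1 d2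
  refine ⟨fun x => 2 * ∫ t in (0 : ℝ)..x,
    (A (x - t) t * u (x - 2 * t) + H (x - t) t * u₁ (x - 2 * t)), fun x => ⟨?_, ?_⟩⟩
  · simp_rw [integral_kernelK_mul]
    refine ((d1 x).const_mul 2).congr_deriv ?_
    simp [hH, goursatFun]
  · refine ((d2 x).const_mul 2).congr_deriv ?_
    have canti : ∀ {f : ℝ → ℝ → ℂ}, Continuous (Function.uncurry f) →
        Continuous fun t => f (x - t) t := fun hf =>
      hf.comp (f := fun t : ℝ => (x - t, t)) (by fun_prop)
    have cp' := canti hp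
    have cA' := canti cA
    have cB' := canti cB
    have cH' := canti cH
    -- Along the segment, `d/dt H(x-t,t) = B - A`. The boundary term `-H(x,0) u₁(x)` cancels the one
    -- produced by `d2`.
    have ibp : ∫ t in (0 : ℝ)..x, ((B (x - t) t - A (x - t) t) * u₁ (x - 2 * t) -
        2 * (H (x - t) t * u₂ (x - 2 * t))) = H 0 x * u₁ (-x) - H x 0 * u₁ x := by
      have := intervalIntegral.integral_eq_sub_of_hasDerivAt (a := 0) (b := x)
        (f := fun t => H (x - t) t * u₁ (x - 2 * t))
        (f' := fun t => (B (x - t) t - A (x - t) t) * u₁ (x - 2 * t) -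
          2 * (H (x - t) t * u₂ (x - 2 * t)))
        (fun t _ => by
          have h1 := hasDerivAt_comp_of_partial cA cB dA dB (t := t)
            ((hasDerivAt_id' t).const_sub x) (hasDerivAt_id' t)
          have h2 : HasDerivAt (fun t => u₁ (x - 2 * t)) ((-2 : ℝ) • u₂ (x - 2 * t)) t :=
            HasDerivAt.scomp (h := fun t => x - 2 * t) t (hu₁ (x - 2 * t))
              ((((hasDerivAt_id' t).const_mul (2 : ℝ)).const_sub x).congr_deriv (by norm_num))
          refine (h1.mul h2).congr_deriv ?_
          simp only [Complex.real_smul]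
          push_cast
          ring)
        (Continuous.intervalIntegrable (by fun_prop) _ _)
      rw [this, sub_self, sub_zero, mul_zero, sub_zero]
      congr 3
      ring
    have split : ∫ t in (0 : ℝ)..x, ((p (x - t) t * u (x - 2 * t) - A (x - t) t * u₁ (x - 2 * t)) +
          (B (x - t) t * u₁ (x - 2 * t) - H (x - t) t * u₂ (x - 2 * t))) =
        (∫ t in (0 : ℝ)..x, p (x - t) t * u (x - 2 * t)) +
        (∫ t in (0 : ℝ)..x, ((B (x - t) t - A (x - t) t) * u₁ (x - 2 * t) -
          2 * (H (x - t) t * u₂ (x - 2 * t)))) +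
        ∫ t in (0 : ℝ)..x, H (x - t) t * u₂ (x - 2 * t) := by
      rw [← intervalIntegral.integral_add (Continuous.intervalIntegrable (by fun_prop) _ _)
          (Continuous.intervalIntegrable (by fun_prop) _ _),
        ← intervalIntegral.integral_add (Continuous.intervalIntegrable (by fun_prop) _ _)
          (Continuous.intervalIntegrable (by fun_prop) _ _)]
      congr 1 with t
      ring
    rw [split, ibp, integral_kernelK_mul]
    have h1 : H 0 x = 0 := by simp [hH, goursatFun]
    have h2 : A x 0 = 1 / 2 * onReal ha q x := by simp [hA]
    rw [h1, h2]
    ring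

end

/-! ### Reduction of general `h` to `h = 0` -/

theorem hasDerivAt_integral_symmetric {f : ℝ → ℂ} (hf : Continuous f) (x : ℝ) :
    HasDerivAt (fun y => ∫ t in (-y)..y, f t) (f x + f (-x)) x := by
  simp_rw [integral_symmetric_eq hf]
  exact (Continuous.integral_hasStrictDerivAt (f := fun t => f t + f (-t))
    (by fun_prop) 0 x).hasDerivAt

/-- `𝐓_h = 𝐓_0 S_h` with `S_h u(x) = u(x) + (h/2) ∫_{-x}^{x} u`. -/
theorem integral_kernelKh_mul {H : ℝ → ℝ → ℂ} (hH : Continuous (Function.uncurry H)) (h : ℂ)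
    {u : ℝ → ℂ} (hu : Continuous u) (x : ℝ) :
    ∫ t in (-x)..x, kernelKh H h x t * u t =
      h / 2 * (∫ t in (-x)..x, u t) +
        ∫ t in (-x)..x, kernelK H x t * (u t + h / 2 * ∫ s in (-t)..t, u s) := by
  have cK : Continuous fun t => kernelK H x t :=
    hH.comp (f := fun t : ℝ => ((x + t) / 2, (x - t) / 2)) (by fun_prop)
  set k : ℝ → ℂ := fun s => kernelK H x s - kernelK H x (-s) with hk
  have ck : Continuous k := by fun_prop
  set A : ℝ → ℂ := fun t => ∫ s in t..x, k s with hA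
  set V : ℝ → ℂ := fun t => ∫ s in (-t)..t, u s with hV
  have dV : ∀ t, HasDerivAt V (u t + u (-t)) t := hasDerivAt_integral_symmetric hu
  have dA : ∀ t, HasDerivAt A (-k t) t := fun t => by
    have := ((ck.integral_hasStrictDerivAt x t).hasDerivAt).neg
    refine this.congr_of_eventuallyEq (.of_forall fun y => ?_)
    exact intervalIntegral.integral_symm _ _
  have cV : Continuous V := continuous_iff_continuousAt.2 fun t => (dV t).continuousAt
  have cA : Continuous A := continuous_iff_continuousAt.2 fun t => (dA t).continuousAt
  have hAe : ∀ t, A (-t) = A t := fun t => by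
    have h1 : ∫ s in (-t)..t, k s = 0 := by
      rw [integral_symmetric_eq ck]
      simp [hk]
    simp only [hA]
    rw [← intervalIntegral.integral_add_adjacent_intervals (ck.intervalIntegrable (-t) t)
      (ck.intervalIntegrable t x), h1, zero_add]
  have hVo : ∀ t, V (-t) = -V t := fun t => by
    simp only [hV, neg_neg]
    exact intervalIntegral.integral_symm _ _
  -- `A` is even because `k` is odd, and `V` is odd. After folding, the difference of the two sides
  -- is the integral over `[0,x]` of `(V A)'`, and `V A` vanishes at both ends.
  have key : ∫ t in (-x)..x, A t * u t = ∫ t in (-x)..x, kernelK H x t * V t := by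
    rw [integral_symmetric_eq (by fun_prop), integral_symmetric_eq (by fun_prop), ← sub_eq_zero,
      ← intervalIntegral.integral_sub (Continuous.intervalIntegrable (by fun_prop) _ _)
        (Continuous.intervalIntegrable (by fun_prop) _ _)]
    have := intervalIntegral.integral_eq_sub_of_hasDerivAt (a := 0) (b := x)
      (f := fun t => V t * A t) (fun t _ => (dV t).mul (dA t))
      (Continuous.intervalIntegrable (by fun_prop) _ _)
    have hAx : A x = 0 := by simp [hA]
    have hV0 : V 0 = 0 := by simp [hV]
    rw [hAx, hV0, mul_zero, zero_mul, sub_zero] at this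
    rw [← this]
    congr 1 with t
    rw [hAe, hVo]
    simp only [hk]
    ring
  calc ∫ t in (-x)..x, kernelKh H h x t * u t
      = ∫ t in (-x)..x, (h / 2 * u t + kernelK H x t * u t + h / 2 * (A t * u t)) := by
        congr 1 with t
        simp only [kernelKh, hA, hk]
        ring
    _ = h / 2 * (∫ t in (-x)..x, u t) + (∫ t in (-x)..x, kernelK H x t * u t) +
        h / 2 * ∫ t in (-x)..x, A t * u t := by
        rw [intervalIntegral.integral_add (Continuous.intervalIntegrable (by fun_prop) _ _)
            (Continuous.intervalIntegrable (by fun_prop) _ _),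
          intervalIntegral.integral_add (Continuous.intervalIntegrable (by fun_prop) _ _)
            (Continuous.intervalIntegrable (by fun_prop) _ _),
          intervalIntegral.integral_const_mul, intervalIntegral.integral_const_mul]
    _ = h / 2 * (∫ t in (-x)..x, u t) +
        ∫ t in (-x)..x, (kernelK H x t * u t + h / 2 * (kernelK H x t * V t)) := by
        rw [key, intervalIntegral.integral_add (Continuous.intervalIntegrable (by fun_prop) _ _)
            (Continuous.intervalIntegrable (by fun_prop) _ _),
          intervalIntegral.integral_const_mul, add_assoc]
    _ = _ := by
        congr 2 with t
        ring

theorem continuous_kernelKh {H : ℝ → ℝ → ℂ} (hH : Continuous (Function.uncurry H)) (h : ℂ) :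
    Continuous (Function.uncurry (kernelKh H h)) := by
  have cK : Continuous fun z : ℝ × ℝ => kernelK H z.1 z.2 :=
    hH.comp (f := fun z : ℝ × ℝ => ((z.1 + z.2) / 2, (z.1 - z.2) / 2)) (by fun_prop)
  have ck : Continuous (Function.uncurry fun x s : ℝ => kernelK H x s - kernelK H x (-s)) :=
    cK.sub (cK.comp (continuous_id.prodMap continuous_neg))
  have hI : ∀ x t : ℝ, ∫ s in t..x, (kernelK H x s - kernelK H x (-s)) =
      (∫ s in (0 : ℝ)..x, (kernelK H x s - kernelK H x (-s))) -
        ∫ s in (0 : ℝ)..t, (kernelK H x s - kernelK H x (-s)) := fun x t => by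
    have hi : ∀ b, IntervalIntegrable (fun s => kernelK H x s - kernelK H x (-s)) volume 0 b :=
      fun b => (ck.comp (Continuous.prodMk_right x)).intervalIntegrable _ _
    exact (intervalIntegral.integral_interval_sub_left (hi _) (hi _)).symm
  have hprim := intervalIntegral.continuous_parametric_primitive_of_continuous
    (μ := volume) (a₀ := 0) ck
  have hK : Function.uncurry (kernelKh H h) = fun z => h / 2 + kernelK H z.1 z.2 + h / 2 *
      ((∫ s in (0 : ℝ)..z.1, (kernelK H z.1 s - kernelK H z.1 (-s))) -
        ∫ s in (0 : ℝ)..z.2, (kernelK H z.1 s - kernelK H z.1 (-s))) := by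
    ext z
    rw [← hI]
    rfl
  rw [hK]
  exact (continuous_const.add cK).add (continuous_const.mul
    ((hprim.comp (f := fun z : ℝ × ℝ => (z.1, z.1)) (by fun_prop)).sub hprim))

section

variable {a : ℝ} (ha : 0 < a) {q : CSpace a} {p : ℝ → ℝ → ℂ}

/-- The intertwining relation for functions on the whole line. -/
theorem exists_second_deriv_integral_kernelKh (hp : Continuous (Function.uncurry p))
    (hpq : ∀ u ∈ Icc (-a) a, ∀ v ∈ Icc (-a) a,
      p u v = onReal ha q (u + v) * goursatFun ha q p u v) (h : ℂ)
    {u u₁ u₂ : ℝ → ℂ} (hu : ∀ x, HasDerivAt u (u₁ x) x) (hu₁ : ∀ x, HasDerivAt u₁ (u₂ x) x)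
    (hu₂ : Continuous u₂) :
    ∃ y₁ y₂ : ℝ → ℂ,
      (∀ x, HasDerivAt (fun x => u x + ∫ t in (-x)..x, kernelKh (goursatFun ha q p) h x t * u t)
        (y₁ x) x) ∧ (∀ x, HasDerivAt y₁ (y₂ x) x) ∧
      ∀ x ∈ Icc (-a) a, y₂ x =
        onReal ha q x * (u x + ∫ t in (-x)..x, kernelKh (goursatFun ha q p) h x t * u t) +
        (u₂ x + ∫ t in (-x)..x, kernelKh (goursatFun ha q p) h x t * u₂ t) := by
  have cH := continuous_goursatFun ha (q := q) hp
  have cu : Continuous u := continuous_iff_continuousAt.2 fun x => (hu x).continuousAt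
  have cu₁ : Continuous u₁ := continuous_iff_continuousAt.2 fun x => (hu₁ x).continuousAt
  set S : (ℝ → ℂ) → ℝ → ℂ := fun f x => f x + h / 2 * ∫ s in (-x)..x, f s with hS
  have hT : ∀ f : ℝ → ℂ, Continuous f → ∀ x,
      f x + ∫ t in (-x)..x, kernelKh (goursatFun ha q p) h x t * f t =
        S f x + ∫ t in (-x)..x, kernelK (goursatFun ha q p) x t * S f t := fun f hf x => by
    rw [integral_kernelKh_mul cH h hf, ← add_assoc]
  have dS : ∀ x, HasDerivAt (S u) (u₁ x + h / 2 * (u x + u (-x))) x := fun x =>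
    (hu x).add ((hasDerivAt_integral_symmetric cu x).const_mul _)
  -- `S` commutes with the second derivative, as `u₁(x) - u₁(-x)` is the integral of `u₂` over
  -- `[-x,x]`.
  have dS₁ : ∀ x, HasDerivAt (fun x => u₁ x + h / 2 * (u x + u (-x))) (S u₂ x) x := fun x => by
    have h1 : HasDerivAt (fun x => u (-x)) (-u₁ (-x)) x := by
      simpa [Function.comp_def] using! (hu (-x)).scomp x (hasDerivAt_neg x)
    refine ((hu₁ x).add (((hu x).add h1).const_mul _)).congr_deriv ?_
    simp only [hS]
    rw [intervalIntegral.integral_eq_sub_of_hasDerivAt (fun t _ => hu₁ t)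
      (hu₂.intervalIntegrable _ _), sub_eq_add_neg]
  have cS₂ : Continuous (S u₂) := hu₂.add (continuous_const.mul
    (continuous_iff_continuousAt.2 fun x => (hasDerivAt_integral_symmetric hu₂ x).continuousAt))
  obtain ⟨D, hD⟩ := exists_second_deriv_integral_kernelK ha (q := q) hp dS dS₁ cS₂
  simp_rw [hT u cu, hT u₂ hu₂]
  refine ⟨_, _, fun x => (dS x).add (hD x).1, fun x => (dS₁ x).add (hD x).2, fun x hx => ?_⟩
  have h0 : (0 : ℝ) ∈ Icc (-a) a := ⟨by linarith, ha.le⟩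
  -- On the characteristic segment `(x - t) + t = x`, so `q` is constant there and leaves the
  -- integral.
  have hint : 2 * ∫ t in (0 : ℝ)..x, p (x - t) t * S u (x - 2 * t) =
      onReal ha q x * ∫ t in (-x)..x, kernelK (goursatFun ha q p) x t * S u t := by
    rw [integral_kernelK_mul, mul_left_comm, ← intervalIntegral.integral_const_mul (onReal ha q x)]
    congr 1
    refine intervalIntegral.integral_congr fun t ht => ?_
    have hxt : x - t ∈ uIcc 0 x := by
      rcases le_total 0 x with hx0 | hx0
      · rw [uIcc_of_le hx0] at ht ⊢
        constructor <;> linarith [ht.1, ht.2]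
      · rw [uIcc_of_ge hx0] at ht ⊢
        constructor <;> linarith [ht.1, ht.2]
    have hsub := uIcc_subset_Icc h0 hx
    rw [hpq _ (hsub hxt) _ (hsub ht), sub_add_cancel, mul_assoc]
  rw [hint]
  ring

end

/-! ### Passage between the line and `[-a,a]` -/

theorem contDiffOn_two_of_hasDerivAt {s : Set ℝ} (hs : UniqueDiffOn ℝ s) {f g g₁ g₂ : ℝ → ℂ}
    (hfg : EqOn f g s) (hg : ∀ x, HasDerivAt g (g₁ x) x) (hg₁ : ∀ x, HasDerivAt g₁ (g₂ x) x)
    (hg₂ : ContinuousOn g₂ s) :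
    ContDiffOn ℝ 2 f s ∧ ∀ x ∈ s, iteratedDerivWithin 2 f s x = g₂ x := by
  have e₁ : EqOn (derivWithin g s) g₁ s := fun x hx =>
    (hg x).hasDerivWithinAt.derivWithin (hs x hx)
  have e₂ : EqOn (derivWithin g₁ s) g₂ s := fun x hx =>
    (hg₁ x).hasDerivWithinAt.derivWithin (hs x hx)
  have c₁ : ContDiffOn ℝ 1 g₁ s := by
    refine (contDiffOn_succ_iff_derivWithin (n := 0) hs).2
      ⟨fun x _ => (hg₁ x).differentiableAt.differentiableWithinAt, by simp, ?_⟩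
    exact contDiffOn_zero.2 (hg₂.congr e₂)
  have c₂ : ContDiffOn ℝ 2 g s := by
    rw [show (2 : WithTop ℕ∞) = 1 + 1 by norm_num]
    exact (contDiffOn_succ_iff_derivWithin hs).2
      ⟨fun x _ => (hg x).differentiableAt.differentiableWithinAt, by simp, c₁.congr e₁⟩
  refine ⟨c₂.congr hfg, fun x hx => ?_⟩
  rw [iteratedDerivWithin_congr hfg hx, iteratedDerivWithin_succ, ← e₂ hx]
  refine derivWithin_congr (fun y hy => ?_) ?_
  · rw [iteratedDerivWithin_one, e₁ hy]
  · rw [iteratedDerivWithin_one, e₁ hx]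

section

variable {a : ℝ} (ha : 0 < a)

/-- The constant extension of `u` need not be differentiable at the end points. Instead its second
derivative is extended constantly and integrated twice from the data at `0`. -/
theorem exists_extension_C2 (u : C2Space ha) :
    ∃ g g₁ : ℝ → ℂ, (∀ x, HasDerivAt g (g₁ x) x) ∧
      (∀ x, HasDerivAt g₁ (onReal ha (secondDeriv ha u) x) x) ∧
      EqOn g (onReal ha u) (Icc (-a) a) := by
  set f := onReal ha (u : CSpace a) with hf
  set I := Icc (-a) a with hI
  have hu : ContDiffOn ℝ 2 f I := u.2
  have hs := uniqueDiffOn_seg ha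
  have h0 : (0 : ℝ) ∈ I := ⟨by linarith, ha.le⟩
  set g₂ := onReal ha (secondDeriv ha u)
  have hg₂ : ∀ x ∈ I, g₂ x = derivWithin (derivWithin f I) I x := fun x hx => by
    have h : g₂ x = iteratedDerivWithin 2 f I x := onReal_of_mem ha _ hx
    rw [h, iteratedDerivWithin_succ]
    exact derivWithin_congr (fun y _ => by rw [iteratedDerivWithin_one])
      (by rw [iteratedDerivWithin_one])
  have d₀ : ∀ x ∈ I, HasDerivWithinAt f (derivWithin f I x) I x := fun x hx =>
    (hu.differentiableOn (by norm_num) x hx).hasDerivWithinAt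
  have d₁ : ∀ x ∈ I, HasDerivWithinAt (derivWithin f I) (g₂ x) I x := fun x hx => by
    rw [hg₂ x hx]
    exact ((hu.derivWithin (m := 1) hs (by norm_num)).differentiableOn (by norm_num) x
      hx).hasDerivWithinAt
  have cg₂ : Continuous g₂ := continuous_onReal ha _
  set g₁ : ℝ → ℂ := fun x => derivWithin f I 0 + ∫ t in (0 : ℝ)..x, g₂ t with hg₁
  have dg₁ : ∀ x, HasDerivAt g₁ (g₂ x) x := fun x =>
    (cg₂.integral_hasStrictDerivAt 0 x).hasDerivAt.const_add _
  have cg₁ : Continuous g₁ := continuous_iff_continuousAt.2 fun x => (dg₁ x).continuousAt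
  set g : ℝ → ℂ := fun x => f 0 + ∫ t in (0 : ℝ)..x, g₁ t with hg
  have dg : ∀ x, HasDerivAt g (g₁ x) x := fun x =>
    (cg₁.integral_hasStrictDerivAt 0 x).hasDerivAt.const_add _
  have huniq : ∀ {φ ψ χ : ℝ → ℂ}, (∀ x, HasDerivAt φ (χ x) x) →
      (∀ x ∈ I, HasDerivWithinAt ψ (χ x) I x) → φ 0 = ψ 0 → EqOn φ ψ I := by
    intro φ ψ χ hφ hψ h x hx
    have hsub : uIcc 0 x ⊆ I := uIcc_subset_Icc h0 hx
    -- With `c = 0`: a function with zero derivative and zero value at `0` vanishes.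
    have := norm_le_pow_div_factorial_of_deriv (f := fun y => φ y - ψ y) (f' := fun _ => 0)
      (x := x) (c := 0) (n := 0)
      (fun s hs => by
        exact ((hφ s).hasDerivWithinAt.sub ((hψ s (hsub hs)).mono hsub)).congr_deriv
          (sub_self _))
      (sub_eq_zero.2 h) (by simp)
    rw [zero_mul] at this
    exact sub_eq_zero.1 (norm_le_zero_iff.1 this)
  have e₁ : EqOn g₁ (derivWithin f I) I := huniq dg₁ d₁ (by simp [hg₁])
  exact ⟨g, g₁, dg, dg₁, huniq dg (fun x hx => by rw [e₁ hx]; exact d₀ x hx) (by simp [hg])⟩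

/-! ### The transmutation property -/

/-- The Goursat problem and the transmutation property, for every continuous `q`. -/
theorem exists_goursat_transmutation (q : CSpace a) :
    ∃ H : ℝ → ℝ → ℂ,
      IsGoursatSolution ha q H ∧
      (∀ H' : ℝ → ℝ → ℂ, IsGoursatSolution ha q H' →
        ∀ u v : ℝ, (u, v) ∈ goursatDomain a → H' u v = H u v) ∧
      ∀ h : ℂ, ∃ T : CSpace a ≃L[ℂ] CSpace a,
        (∀ (u : CSpace a) (x : Icc (-a) a), T u x = operatorTh ha H h u x) ∧
        IsTransmutation (schrodinger ha q) (-secondDeriv ha) T := by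
  obtain ⟨p, hp, hpq⟩ := exists_goursat_density ha q
  have hH := isGoursatSolution_goursatFun ha hp hpq
  refine ⟨goursatFun ha q p, hH, fun H' hH' u v huv => hH.unique ha hH' huv, fun h => ?_⟩
  obtain ⟨W, hW, U, hU⟩ :=
    exists_volterra ha (continuous_kernelKh (continuous_goursatFun ha (q := q) hp) h)
  have hT : ∀ (u : CSpace a) (x : Icc (-a) a), ContinuousLinearEquiv.ofUnit U u x =
      u x + ∫ t in (-(x : ℝ))..(x : ℝ), kernelKh (goursatFun ha q p) h x t * onReal ha u t :=
    fun u x => by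
      rw [← hW]
      change (U : CSpace a →L[ℂ] CSpace a) u x = _
      rw [hU]
      rfl
  refine ⟨ContinuousLinearEquiv.ofUnit U, hT, ?_⟩
  generalize ContinuousLinearEquiv.ofUnit U = T at hT
  -- The intertwining relation in the form `(T u)'' = q T u + T u''`, obtained from the extension of
  -- `u` to the line.
  have main : ∀ u : C2Space ha, ContDiffOn ℝ 2 (onReal ha (T u)) (Icc (-a) a) ∧
      ∀ x ∈ Icc (-a) a, iteratedDerivWithin 2 (onReal ha (T u)) (Icc (-a) a) x =
        onReal ha (q * T u + T (secondDeriv ha u)) x := by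
    intro u
    obtain ⟨g, g₁, dg, dg₁, hgu⟩ := exists_extension_C2 ha u
    obtain ⟨y₁, y₂, dy, dy₁, hy₂⟩ := exists_second_deriv_integral_kernelKh ha hp hpq h dg dg₁
      (continuous_onReal ha _)
    have hTu : ∀ x ∈ Icc (-a) a, onReal ha (T u) x =
        g x + ∫ t in (-x)..x, kernelKh (goursatFun ha q p) h x t * g t := fun x hx => by
      rw [onReal_of_mem ha _ hx, hT, hgu hx, onReal_of_mem ha _ hx]
      congr 1
      refine intervalIntegral.integral_congr fun t ht => ?_
      dsimp only
      rw [hgu (mem_Icc_of_mem_uIcc hx ht)]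
    have hy : ∀ x ∈ Icc (-a) a, y₂ x = onReal ha (q * T u + T (secondDeriv ha u)) x :=
      fun x hx => by
        rw [hy₂ x hx, ← hTu x hx]
        simp only [onReal_of_mem ha _ hx, ContinuousMap.add_apply, ContinuousMap.mul_apply]
        rw [hT (secondDeriv ha u)]
    obtain ⟨h1, h2⟩ := contDiffOn_two_of_hasDerivAt (uniqueDiffOn_seg ha) hTu dy dy₁
      ((continuous_onReal ha _).continuousOn.congr hy)
    exact ⟨h1, fun x hx => (h2 x hx).trans (hy x hx)⟩
  refine ⟨fun u hu => (main ⟨u, hu⟩).1, fun u => ?_⟩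
  ext x
  have h2 := (main u).2 x x.2
  rw [onReal_coe] at h2
  change -iteratedDerivWithin 2 (onReal ha (T u)) (Icc (-a) a) x + q x * T u x =
    T (-secondDeriv ha u) x
  rw [h2, map_neg]
  simp only [ContinuousMap.add_apply, ContinuousMap.mul_apply, ContinuousMap.neg_apply]
  ring

end

end Transmutation

theorem mainTheorem3 (a : ℝ) (ha : 0 < a) (q : Transmutation.CSpace a)
    (hq : ContDiffOn ℝ 1 (Transmutation.onReal ha q) (Set.Icc (-a) a) ∨
      ∃ g : Transmutation.C2Space ha, Transmutation.secondDeriv ha g - q * (g : Transmutation.CSpace a) = 0 ∧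
        ∀ x : Set.Icc (-a) a, (g : Transmutation.CSpace a) x ≠ 0) :
    ∃ H : ℝ → ℝ → ℂ,
      Transmutation.IsGoursatSolution ha q H ∧
      (∀ H' : ℝ → ℝ → ℂ, Transmutation.IsGoursatSolution ha q H' →
        ∀ u v : ℝ, (u, v) ∈ Transmutation.goursatDomain a → H' u v = H u v) ∧
      ∀ h : ℂ, ∃ T : Transmutation.CSpace a ≃L[ℂ] Transmutation.CSpace a,
        (∀ (u : Transmutation.CSpace a) (x : Set.Icc (-a) a),
          T u x = Transmutation.operatorTh ha H h u x) ∧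
        Transmutation.IsTransmutation (Transmutation.schrodinger ha q)
          (-Transmutation.secondDeriv ha) T :=
  Transmutation.exists_goursat_transmutation ha q
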